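/- Let $\mu\in(0,1/2)$ and let $\phi:\mathbb R\to\mathbb R$ be an even analytic function such that $$\overline\Psi(x,y)=|y|\,\phi(|x|/|y|)\ \ (|y|>0),\qquad \overline\Psi(x,y)=|x|\,\phi(|y|/|x|)\ \ (|x|>0)$$ is a well-defined uniformly elliptic integrand on $\mathbb R^4=\mathbb R^2\times\mathbb R^2$ (one-homogeneous, positive and smooth away from the origin, with $\{\overline\Psi<1\}$ uniformly convex), and such that $$\frac{\phi(1)}{2\phi''(1)}=\mu(1-\mu).$$ Put $P=\phi'/\phi''$ and $Q(s)=(s\phi'(s)-\phi(s))/\phi''(s)$. Then there is a constant $c>0$, depending only on $\phi$ (and on $\mu$, which $\phi$ determines), with the following property. Let $\sigma:\mathbb R\to\mathbb R$ be even, analytic, with $\sigma''>0$, $\sigma(0)=1$ and $\sigma(\tau)>|\tau|$ for all $\tau$, solving $$G(\sigma)(\tau):=\sigma''(\tau)+\frac1\tau P(\sigma'(\tau))+\frac1{\sigma(\tau)}Q(\sigma'(\tau))=0\qquad(\tau>0),$$ and such that for every $\tau>0$ the point $(w,z)=(\sigma(\tau)/\tau,\sigma'(\tau))$ lies in the region $\{0<z<1\}\cap\{z>3/2-w/2\}$.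 Then there exist $a>0$ and $b\in\mathbb R$ such that $$\sigma(\tau)=\tau+a\tau^{-\mu}+b\tau^{\mu-1}+F(\tau)\qquad(\tau>0),$$ where $F$ is smooth on $(0,\infty)$ and, with $h(\tau)=\tau^{-1-2\mu}$, satisfies for all $\tau\ge1$ $$|F(\tau)|\le c^{-1}|h(\tau)|,\qquad |F'(\tau)|\le c^{-1}|h'(\tau)|,\qquad |F''(\tau)|\le c^{-1}|h''(\tau)|.$$ -/

import Mathlib

open Set
open scoped ContDiff

/-- The space `ℝ⁴ = ℝ² × ℝ²` of points `(x, y)`, with its Euclidean norm. -/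
abbrev R22 : Type :=
  WithLp 2 (EuclideanSpace ℝ (Fin 2) × EuclideanSpace ℝ (Fin 2))

/-- A uniformly elliptic integrand: one-homogeneous, positive and smooth away from the origin,
and such that `{Φ < 1}` is uniformly convex. The second fundamental form of `{Φ = 1}` at `p` in a
tangent direction `e` is `D²Φ(p)(e, e) / |∇Φ(p)|`, so (`|∇Φ|` being bounded above and below on the
compact set `{Φ = 1}`) uniform convexity is a positive lower bound for `D²Φ(p)` on the tangent
space of `{Φ = 1}` at `p`. -/
structure IsUniformlyElliptic {E : Type*} [NormedAddCommGroup E] [InnerProductSpace ℝ E]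
    (Φ : E → ℝ) : Prop where
  homogeneous : ∀ (t : ℝ) (p : E), 0 ≤ t → Φ (t • p) = t * Φ p
  pos : ∀ p : E, p ≠ 0 → 0 < Φ p
  smooth : ContDiffOn ℝ ∞ Φ {p : E | p ≠ 0}
  uniformlyConvex : ∃ κ > (0 : ℝ), ∀ p e : E, Φ p = 1 → fderiv ℝ Φ p e = 0 →
    κ * ‖e‖ ^ 2 ≤ iteratedDeriv 2 (fun t : ℝ => Φ (p + t • e)) 0

open Classical in
/-- The integrand `(x, y) ↦ |y| φ(|x|/|y|)` for `|y| > 0`, `|x| φ(|y|/|x|)` for `|x| > 0`. -/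
noncomputable def integrand (φ : ℝ → ℝ) (p : R22) : ℝ :=
  if 0 < ‖p.snd‖ then ‖p.snd‖ * φ (‖p.fst‖ / ‖p.snd‖) else ‖p.fst‖ * φ (‖p.snd‖ / ‖p.fst‖)

/-- `φ` is an even analytic function for which the two formulas defining `integrand φ` agree where
both apply, `integrand φ` is a uniformly elliptic integrand on `ℝ⁴`, and `μ` is related to `φ`
through `φ(1) / (2 φ''(1)) = μ (1 - μ)`. -/
structure IsIntegrandProfile (μ : ℝ) (φ : ℝ → ℝ) : Prop where
  analytic : AnalyticOnNhd ℝ φ univ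
  even : ∀ s, φ (-s) = φ s
  compat : ∀ s t : ℝ, 0 < s → 0 < t → t * φ (s / t) = s * φ (t / s)
  elliptic : IsUniformlyElliptic (integrand φ)
  mu_eq : φ 1 / (2 * iteratedDeriv 2 φ 1) = μ * (1 - μ)

/-- `P = φ' / φ''`. -/
noncomputable def coeffP (φ : ℝ → ℝ) (s : ℝ) : ℝ :=
  deriv φ s / iteratedDeriv 2 φ s

/-- `Q = (s φ' - φ) / φ''`. -/
noncomputable def coeffQ (φ : ℝ → ℝ) (s : ℝ) : ℝ :=
  (s * deriv φ s - φ s) / iteratedDeriv 2 φ s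

/-- `G(σ)(τ) = σ''(τ) + P(σ'(τ)) / τ + Q(σ'(τ)) / σ(τ)`, for `τ ≠ 0`. -/
noncomputable def opG (φ σ : ℝ → ℝ) (τ : ℝ) : ℝ :=
  iteratedDeriv 2 σ τ + 1 / τ * coeffP φ (deriv σ τ) + 1 / σ τ * coeffQ φ (deriv σ τ)

/-- `σ` is the profile of a leaf `{|y| = σ(|x|)}`: even, analytic, locally uniformly convex, larger
than `|·|`, with `σ(0) = 1`, solving `G(σ) = 0`, and such that the curve
`(w, z) = (σ(τ)/τ, σ'(τ))`, `τ > 0`, stays in `{0 < z < 1} ∩ {z > 3/2 - w/2}`. -/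
structure IsLeafProfile (φ σ : ℝ → ℝ) : Prop where
  even : ∀ τ, σ (-τ) = σ τ
  analytic : AnalyticOnNhd ℝ σ univ
  convex : ∀ τ, 0 < iteratedDeriv 2 σ τ
  gt_abs : ∀ τ, |τ| < σ τ
  zero : σ 0 = 1
  ode : ∀ τ, 0 < τ → opG φ σ τ = 0
  trapped : ∀ τ, 0 < τ →
    0 < deriv σ τ ∧ deriv σ τ < 1 ∧ 3 / 2 - σ τ / τ / 2 < deriv σ τ

/-- `F` is a term of the form `𝓕(h)` with constant `c`: it is smooth on `(0, ∞)` and is bounded by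
`c⁻¹ |h|` together with its first two derivatives, for `τ ≥ 1`. -/
structure IsControlledBy (c : ℝ) (h F : ℝ → ℝ) : Prop where
  smooth : ContDiffOn ℝ ∞ F (Ioi 0)
  bound_zero : ∀ τ, 1 ≤ τ → |F τ| ≤ c⁻¹ * |h τ|
  bound_one : ∀ τ, 1 ≤ τ → |deriv F τ| ≤ c⁻¹ * |deriv h τ|
  bound_two : ∀ τ, 1 ≤ τ → |iteratedDeriv 2 F τ| ≤ c⁻¹ * |iteratedDeriv 2 h τ|

/-!
Write `σ(τ) = τ + u(τ)`. Differentiating the compatibility relation `φ(s) = s φ(1/s)` at `s = 1`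
gives `P(1) = μ(1-μ) = -Q(1)`, whence `P'(1) + Q'(1) = 2`. So, up to terms quadratic in `(u/τ, u')`,
the equation `G(σ) = 0` is the Euler equation `τ²u'' + 2τu' + μ(1-μ)u = 0`, whose solutions are
spanned by `τ ^ (-μ)` and `τ ^ (μ-1)`.

The trapping hypotheses say that `-u/(2τ) < u' < 0`. Hence `u` is bounded by `u(0) = 1`, and the
quadratic error is `O(u²/τ)` (`IsLeafProfile.exists_euler_le`). The Euler operator is
`(τ∂ + μ)(τ∂ + 1 - μ)`, so integrating its two factors from infinity, with right-hand side
`O(1/τ)`, gives `u = O(τ ^ (-μ))`. The right-hand side is therefore `O(τ ^ (-1-2μ))`, and a second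
integration gives the expansion (`exists_euler_expansion_of_quadratic`). The trapping condition
also makes `τ ^ (1/2) u` increasing, and `τ ^ (μ-1)` decays faster than `τ ^ (-1/2)`; this forces
`a > 0` (`euler_coeff_pos`).

The constant does not depend on `σ` because `φ` admits at most one leaf profile
(`IsLeafProfile.unique`): the condition `σ(0) = 1` and evenness fix the initial data at the singular
point `τ = 0`. Uniform convexity of the integrand enters there, through `φ''(0) > 0`.
-/

open Filter Topology

/-! ### The coefficients `P` and `Q` -/

theorem iteratedDeriv_two_eq (f : ℝ → ℝ) : iteratedDeriv 2 f = deriv (deriv f) := by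
  rw [iteratedDeriv_succ, iteratedDeriv_one]

theorem deriv_zero_of_even {f : ℝ → ℝ} (hf : ∀ x, f (-x) = f x) : deriv f 0 = 0 := by
  have h := deriv_comp_neg f 0
  simp only [hf, neg_zero] at h
  linarith

/-- An analytic function agrees with its first-order Taylor polynomial up to a quadratic error. -/
theorem AnalyticAt.exists_abs_sub_le_sq {f : ℝ → ℝ} {x : ℝ} (hf : AnalyticAt ℝ f x) :
    ∃ K, 0 ≤ K ∧ ∀ᶠ y in 𝓝 (0 : ℝ), |f (x + y) - f x - deriv f x * y| ≤ K * y ^ 2 := by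
  obtain ⟨p, hp⟩ := hf
  have h := hp.isBigO_sub_partialSum_pow 2
  obtain ⟨K, hK, hb⟩ := h.exists_nonneg
  refine ⟨K, hK, hb.bound.mono fun y hy => ?_⟩
  have e : p.partialSum 2 y = f x + deriv f x * y := by
    rw [hp.deriv, FormalMultilinearSeries.partialSum, Finset.sum_range_succ,
      Finset.sum_range_succ, Finset.sum_range_zero, hp.coeff_zero]
    have : (p 1 fun _ => y) = p 1 (fun _ => (1 : ℝ)) * y := by
      simp [mul_comm]
    rw [this, zero_add]
  rw [e] at hy
  simpa only [sub_sub, Real.norm_eq_abs, abs_pow, abs_abs, sq_abs, norm_pow] using hy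

theorem AnalyticOnNhd.deriv_two {f : ℝ → ℝ} (hf : AnalyticOnNhd ℝ f univ) :
    AnalyticOnNhd ℝ (iteratedDeriv 2 f) univ := by
  rw [iteratedDeriv_two_eq]
  exact hf.deriv.deriv

theorem AnalyticOnNhd.coeffP {φ : ℝ → ℝ} (hφ : AnalyticOnNhd ℝ φ univ) {s : ℝ}
    (hs : iteratedDeriv 2 φ s ≠ 0) : AnalyticAt ℝ (coeffP φ) s :=
  (hφ.deriv s trivial).fun_div (hφ.deriv_two s trivial) hs

theorem AnalyticOnNhd.coeffQ {φ : ℝ → ℝ} (hφ : AnalyticOnNhd ℝ φ univ) {s : ℝ}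
    (hs : iteratedDeriv 2 φ s ≠ 0) : AnalyticAt ℝ (coeffQ φ) s :=
  ((analyticAt_id.fun_mul (hφ.deriv s trivial)).fun_sub (hφ s trivial)).fun_div
    (hφ.deriv_two s trivial) hs

theorem deriv_coeffP {φ : ℝ → ℝ} (hφ : AnalyticOnNhd ℝ φ univ) {s : ℝ}
    (hs : iteratedDeriv 2 φ s ≠ 0) :
    deriv (coeffP φ) s = 1 - coeffP φ s * (deriv (iteratedDeriv 2 φ) s / iteratedDeriv 2 φ s) := by
  have h1 : HasDerivAt (deriv φ) (iteratedDeriv 2 φ s) s := by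
    rw [iteratedDeriv_two_eq]
    exact (hφ.deriv s trivial).differentiableAt.hasDerivAt
  have h2 := (hφ.deriv_two s trivial).differentiableAt.hasDerivAt
  refine (h1.fun_div h2 hs).deriv.trans ?_
  unfold coeffP
  field_simp

theorem deriv_coeffQ {φ : ℝ → ℝ} (hφ : AnalyticOnNhd ℝ φ univ) {s : ℝ}
    (hs : iteratedDeriv 2 φ s ≠ 0) :
    deriv (coeffQ φ) s = s - coeffQ φ s * (deriv (iteratedDeriv 2 φ) s / iteratedDeriv 2 φ s) := by
  have h0 := (hφ s trivial).differentiableAt.hasDerivAt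
  have h1 : HasDerivAt (deriv φ) (iteratedDeriv 2 φ s) s := by
    rw [iteratedDeriv_two_eq]
    exact (hφ.deriv s trivial).differentiableAt.hasDerivAt
  have h2 := (hφ.deriv_two s trivial).differentiableAt.hasDerivAt
  refine ((((hasDerivAt_id' s).fun_mul h1).fun_sub h0).fun_div h2 hs).deriv.trans ?_
  unfold coeffQ
  field_simp
  ring

namespace IsIntegrandProfile

variable {μ : ℝ} {φ : ℝ → ℝ}

/-- Differentiate `φ(s) = s φ(1/s)` at `s = 1`. -/
theorem two_mul_deriv_one (hφ : IsIntegrandProfile μ φ) : 2 * deriv φ 1 = φ 1 := by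
  have h0 : HasDerivAt φ (deriv φ 1) 1 := (hφ.analytic 1 trivial).differentiableAt.hasDerivAt
  have h1 : HasDerivAt (fun s : ℝ => s * φ s⁻¹)
      (1 * φ (1 : ℝ)⁻¹ + 1 * (deriv φ 1 * (-((1 : ℝ) ^ 2)⁻¹))) 1 := by
    refine (hasDerivAt_id' (1 : ℝ)).fun_mul ?_
    have h0' : HasDerivAt φ (deriv φ 1) ((1 : ℝ)⁻¹) := by simpa using h0
    exact h0'.comp (1 : ℝ) (hasDerivAt_inv one_ne_zero)
  have h2 : φ =ᶠ[𝓝 1] fun s : ℝ => s * φ s⁻¹ := by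
    filter_upwards [lt_mem_nhds (zero_lt_one' ℝ)] with s hs
    simpa using hφ.compat s 1 hs one_pos
  have h3 := h0.unique (h1.congr_of_eventuallyEq h2)
  simp only [inv_one, one_mul, one_pow] at h3
  linarith

theorem deriv_two_one_ne_zero (hφ : IsIntegrandProfile μ φ) (hμ : 0 < μ) (hμ' : μ < 1 / 2) :
    iteratedDeriv 2 φ 1 ≠ 0 := by
  intro h
  have := hφ.mu_eq
  rw [h, mul_zero, div_zero] at this
  nlinarith

theorem coeffP_one (hφ : IsIntegrandProfile μ φ) : coeffP φ 1 = μ * (1 - μ) := by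
  rw [← hφ.mu_eq, ← hφ.two_mul_deriv_one, coeffP, mul_div_mul_left _ _ two_ne_zero]

theorem coeffQ_one (hφ : IsIntegrandProfile μ φ) : coeffQ φ 1 = -(μ * (1 - μ)) := by
  rw [← hφ.coeffP_one, coeffP, coeffQ, ← hφ.two_mul_deriv_one]
  ring

/-- This sum is the coefficient of `u'/τ` in the linearization of `G` at `σ = τ`. The terms with
`φ'''` cancel because `P(1) + Q(1) = 0`. -/
theorem deriv_coeffP_add_deriv_coeffQ (hφ : IsIntegrandProfile μ φ) (hμ : 0 < μ)
    (hμ' : μ < 1 / 2) : deriv (coeffP φ) 1 + deriv (coeffQ φ) 1 = 2 := by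
  have hs := hφ.deriv_two_one_ne_zero hμ hμ'
  rw [deriv_coeffP hφ.analytic hs, deriv_coeffQ hφ.analytic hs, hφ.coeffP_one, hφ.coeffQ_one]
  ring

theorem coeffP_zero (hφ : IsIntegrandProfile μ φ) : coeffP φ 0 = 0 := by
  rw [coeffP, deriv_zero_of_even hφ.even, zero_div]

/-- Uniform convexity of the integrand in the direction `(e, 0)` at a point `(0, y)`. -/
theorem deriv_two_zero_pos (hφ : IsIntegrandProfile μ φ) : 0 < iteratedDeriv 2 φ 0 := by
  set e : EuclideanSpace ℝ (Fin 2) := EuclideanSpace.single 0 1 with he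
  have hen : ‖e‖ = 1 := by simp [he]
  have hpos : 0 < φ 0 := by
    have h := hφ.elliptic.pos (WithLp.toLp 2 (0, e)) (by
      intro h
      have : e = 0 := congrArg WithLp.snd h
      simp [this] at hen)
    simpa [integrand, hen] using h
  set c : ℝ := (φ 0)⁻¹ with hc
  have hc0 : 0 < c := inv_pos.2 hpos
  set p : R22 := WithLp.toLp 2 (0, c • e) with hp
  set v : R22 := WithLp.toLp 2 (e, 0) with hv
  have hcn : ‖c • e‖ = c := by rw [norm_smul, hen, mul_one, Real.norm_of_nonneg hc0.le]
  have hval : ∀ t : ℝ, integrand φ (p + t • v) = c * φ (c⁻¹ * t) := by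
    intro t
    have h1 : (p + t • v).fst = t • e := by simp [hp, hv]
    have h2 : (p + t • v).snd = c • e := by simp [hp, hv]
    rw [integrand, h1, h2, hcn, if_pos hc0, norm_smul, hen, mul_one, Real.norm_eq_abs,
      div_eq_inv_mul]
    rcases abs_choice t with h | h
    · rw [h]
    · rw [h, mul_neg, hφ.even]
  have hp0 : p ≠ 0 := by
    intro h
    have : c • e = 0 := congrArg WithLp.snd h
    rw [this, norm_zero] at hcn
    exact hc0.ne hcn
  obtain ⟨κ, hκ, h⟩ := hφ.elliptic.uniformlyConvex
  have hΦp : integrand φ p = 1 := by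
    have := hval 0
    rw [zero_smul, add_zero, mul_zero] at this
    rw [this, hc, inv_mul_cancel₀ hpos.ne']
  have hd : DifferentiableAt ℝ (integrand φ) p :=
    (hφ.elliptic.smooth.contDiffAt (isOpen_ne.mem_nhds hp0)).differentiableAt (by simp)
  have hdv : fderiv ℝ (integrand φ) p v = 0 := by
    have h1 : HasDerivAt (fun t : ℝ => integrand φ (p + t • v)) (fderiv ℝ (integrand φ) p v) 0 :=
      hd.hasFDerivAt.hasLineDerivAt v
    rw [← h1.deriv]
    refine deriv_zero_of_even fun t => ?_
    rw [hval, hval, mul_neg, hφ.even]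
  have h2 := h p v hΦp hdv
  have hvn : ‖v‖ = 1 := by rw [WithLp.prod_norm_eq_of_L2]; simp [hv, hen]
  have h3 : (fun t : ℝ => integrand φ (p + t • v)) = fun t => c * φ (c⁻¹ * t) := funext hval
  have hsm : ContDiff ℝ (2 : ℕ) φ := hφ.analytic.contDiff
  rw [h3, hvn, iteratedDeriv_const_mul_field, iteratedDeriv_comp_const_mul hsm] at h2
  simp only [mul_zero] at h2
  have h4 : 0 < c * (c⁻¹ ^ 2 * iteratedDeriv 2 φ 0) := by linarith
  have h5 : 0 < c⁻¹ ^ 2 := by positivity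
  exact pos_of_mul_pos_right (pos_of_mul_pos_right h4 hc0.le) h5.le

theorem deriv_coeffP_zero (hφ : IsIntegrandProfile μ φ) : deriv (coeffP φ) 0 = 1 := by
  rw [deriv_coeffP hφ.analytic hφ.deriv_two_zero_pos.ne', hφ.coeffP_zero, zero_mul, sub_zero]

end IsIntegrandProfile

/-! ### Uniqueness of the leaf profile -/

namespace IsLeafProfile

variable {φ σ σ₁ σ₂ : ℝ → ℝ}

theorem hasDerivAt (h : IsLeafProfile φ σ) (τ : ℝ) : HasDerivAt σ (deriv σ τ) τ :=
  (h.analytic τ trivial).differentiableAt.hasDerivAt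

theorem hasDerivAt_deriv (h : IsLeafProfile φ σ) (τ : ℝ) :
    HasDerivAt (deriv σ) (iteratedDeriv 2 σ τ) τ := by
  rw [iteratedDeriv_two_eq]
  exact (h.analytic.deriv τ trivial).differentiableAt.hasDerivAt

theorem tendsto_deriv_zero (h : IsLeafProfile φ σ) : Tendsto (deriv σ) (𝓝 0) (𝓝 0) := by
  have := (h.hasDerivAt_deriv 0).continuousAt.tendsto
  rwa [deriv_zero_of_even h.even] at this

theorem tendsto_zero (h : IsLeafProfile φ σ) : Tendsto σ (𝓝 0) (𝓝 1) := by
  have := (h.hasDerivAt 0).continuousAt.tendsto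
  rwa [h.zero] at this

/-- The initial value problem `G(σ) = 0`, `σ(0) = 1`, `σ'(0) = 0` has at most one solution. The
singular term `P(σ') / τ` has the good sign because `P` is increasing near `0`, so Grönwall's
inequality applies to `(σ₁ - σ₂)² + (σ₁' - σ₂')²` near `0`; analyticity does the rest. -/
theorem unique {μ : ℝ} (hφ : IsIntegrandProfile μ φ) (h₁ : IsLeafProfile φ σ₁)
    (h₂ : IsLeafProfile φ σ₂) : σ₁ = σ₂ := by
  have hs := hφ.deriv_two_zero_pos.ne'
  have hP : ∀ᶠ τ in 𝓝 (0 : ℝ), 0 ≤ (coeffP φ (deriv σ₁ τ) - coeffP φ (deriv σ₂ τ)) *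
      (deriv σ₁ τ - deriv σ₂ τ) := by
    have h := (hφ.analytic.coeffP hs).hasStrictDerivAt.hasStrictFDerivAt.isLittleO.def
      (one_pos : (0 : ℝ) < 1)
    rw [hφ.deriv_coeffP_zero] at h
    filter_upwards [(h₁.tendsto_deriv_zero.prodMk_nhds h₂.tendsto_deriv_zero).eventually h] with τ hτ
    set A := coeffP φ (deriv σ₁ τ) - coeffP φ (deriv σ₂ τ)
    set z := deriv σ₁ τ - deriv σ₂ τ
    have h' : |A - z| ≤ |z| := by simpa [A, z] using hτ
    -- Squaring `|A - z| ≤ |z|` gives `A ^ 2 ≤ 2 * A * z`, so `A * z` is nonnegative.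
    have h3 := sq_le_sq.2 h'
    nlinarith [sq_nonneg A]
  obtain ⟨K, hQ⟩ : ∃ K : NNReal, ∀ᶠ τ in 𝓝 (0 : ℝ),
      |coeffQ φ (deriv σ₁ τ) / σ₁ τ - coeffQ φ (deriv σ₂ τ) / σ₂ τ| ≤
        K * max |σ₁ τ - σ₂ τ| |deriv σ₁ τ - deriv σ₂ τ| := by
    have hc : ContDiffAt ℝ 1 (fun p : ℝ × ℝ => coeffQ φ p.2 / p.1) (1, 0) := by
      have h := (hφ.analytic.coeffQ hs).contDiffAt (n := 1)
      exact (ContDiffAt.comp ((1 : ℝ), (0 : ℝ)) (g := coeffQ φ) (f := Prod.snd) h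
        contDiffAt_snd).div contDiffAt_fst one_ne_zero
    obtain ⟨K, t, ht, hK⟩ := hc.exists_lipschitzOnWith
    refine ⟨K, ?_⟩
    filter_upwards [(h₁.tendsto_zero.prodMk_nhds h₁.tendsto_deriv_zero).eventually ht,
      (h₂.tendsto_zero.prodMk_nhds h₂.tendsto_deriv_zero).eventually ht] with τ m₁ m₂
    simpa [Prod.dist_eq, Real.dist_eq] using hK.dist_le_mul _ m₁ _ m₂
  obtain ⟨ε, hε, hball⟩ := Metric.eventually_nhds_iff.1 (hP.and hQ)
  set E : ℝ → ℝ := fun τ => (σ₁ τ - σ₂ τ) ^ 2 + (deriv σ₁ τ - deriv σ₂ τ) ^ 2 with hE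
  set E' : ℝ → ℝ := fun τ => 2 * (σ₁ τ - σ₂ τ) * (deriv σ₁ τ - deriv σ₂ τ) +
    2 * (deriv σ₁ τ - deriv σ₂ τ) * (iteratedDeriv 2 σ₁ τ - iteratedDeriv 2 σ₂ τ) with hE'
  have hEd : ∀ τ, HasDerivAt E (E' τ) τ := by
    intro τ
    have d1 := ((h₁.hasDerivAt τ).fun_sub (h₂.hasDerivAt τ)).fun_pow 2
    have d2 := ((h₁.hasDerivAt_deriv τ).fun_sub (h₂.hasDerivAt_deriv τ)).fun_pow 2
    have d3 := d1.fun_add d2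
    simpa only [Nat.cast_ofNat, Nat.add_one_sub_one, pow_one] using d3
  set C : ℝ := 1 + 2 * K with hC
  have hle : ∀ τ ∈ Ioo 0 ε, E' τ ≤ C * E τ := by
    intro τ hτ
    obtain ⟨hA, hB⟩ := hball (y := τ) (by rw [Real.dist_eq, sub_zero, abs_of_pos hτ.1]; exact hτ.2)
    have o₁ := h₁.ode τ hτ.1
    have o₂ := h₂.ode τ hτ.1
    simp only [opG] at o₁ o₂
    set A := coeffP φ (deriv σ₁ τ) - coeffP φ (deriv σ₂ τ) with hAdef
    set B := coeffQ φ (deriv σ₁ τ) / σ₁ τ - coeffQ φ (deriv σ₂ τ) / σ₂ τ with hBdef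
    simp only [hE, hE']
    set d := σ₁ τ - σ₂ τ
    set z := deriv σ₁ τ - deriv σ₂ τ
    have hw : iteratedDeriv 2 σ₁ τ - iteratedDeriv 2 σ₂ τ = -(1 / τ * A) - B := by
      rw [hAdef, hBdef]
      linear_combination o₁ - o₂
    have hmax : |z| * max |d| |z| ≤ d ^ 2 + z ^ 2 := by
      rw [← sq_abs d, ← sq_abs z]
      rcases max_cases |d| |z| with ⟨h, -⟩ | ⟨h, -⟩ <;> rw [h] <;>
        nlinarith [sq_nonneg (|d| - |z|), sq_nonneg |d|, sq_nonneg |z|]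
    have hzB : -(z * B) ≤ K * (d ^ 2 + z ^ 2) := by
      calc -(z * B) ≤ |z| * |B| := by rw [← abs_mul]; exact neg_le_abs _
        _ ≤ |z| * (K * max |d| |z|) := by gcongr
        _ = K * (|z| * max |d| |z|) := by ring
        _ ≤ _ := by gcongr
    have hAz : 0 ≤ 1 / τ * (A * z) := mul_nonneg (one_div_pos.2 hτ.1).le hA
    rw [hw, hC]
    nlinarith [sq_nonneg (d - z)]
  have hW : ∀ τ, HasDerivAt (fun τ => E τ * Real.exp (-C * τ))
      (E' τ * Real.exp (-C * τ) + E τ * (Real.exp (-C * τ) * (-C * 1))) τ := fun τ =>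
    (hEd τ).fun_mul ((hasDerivAt_id' τ).const_mul (-C)).exp
  have hanti : AntitoneOn (fun τ => E τ * Real.exp (-C * τ)) (Ico 0 ε) := by
    refine antitoneOn_of_deriv_nonpos (convex_Ico 0 ε)
      (fun τ _ => (hW τ).continuousAt.continuousWithinAt)
      (fun τ _ => (hW τ).differentiableAt.differentiableWithinAt) ?_
    intro τ hτ
    rw [interior_Ico] at hτ
    rw [(hW τ).deriv]
    nlinarith [hle τ hτ, Real.exp_pos (-C * τ)]
  have hzero : ∀ τ ∈ Ioo 0 ε, σ₁ τ = σ₂ τ := by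
    intro τ hτ
    have h := hanti ⟨le_rfl, hε⟩ ⟨hτ.1.le, hτ.2⟩ hτ.1.le
    have h0 : E 0 = 0 := by
      simp [hE, h₁.zero, h₂.zero, deriv_zero_of_even h₁.even, deriv_zero_of_even h₂.even]
    simp only [h0, zero_mul] at h
    have h' : E τ ≤ 0 := nonpos_of_mul_nonpos_left h (Real.exp_pos _)
    simp only [hE] at h'
    have : (σ₁ τ - σ₂ τ) ^ 2 = 0 :=
      le_antisymm (by linarith [sq_nonneg (deriv σ₁ τ - deriv σ₂ τ)]) (sq_nonneg _)
    exact sub_eq_zero.1 (pow_eq_zero_iff two_ne_zero |>.1 this)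
  refine h₁.analytic.eq_of_frequently_eq h₂.analytic (z₀ := 0) ?_
  have hev : ∀ᶠ τ in 𝓝[>] (0 : ℝ), σ₁ τ = σ₂ τ := by
    filter_upwards [Ioo_mem_nhdsGT hε] with τ hτ using hzero τ hτ
  exact hev.frequently.filter_mono (nhdsWithin_mono _ fun x hx => (ne_of_gt hx : x ≠ 0))

end IsLeafProfile

/-! ### Integration at infinity -/

/-- A function whose derivative is `O(τ ^ (-s-1))` with `s > 0` converges at rate `τ ^ (-s)`. -/
theorem exists_limit_of_deriv_le {f f' : ℝ → ℝ} {C s T : ℝ} (hs : 0 < s) (hT : 0 < T)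
    (hf : ∀ τ, T ≤ τ → HasDerivAt f (f' τ) τ)
    (hb : ∀ τ, T ≤ τ → |f' τ| ≤ C * τ ^ (-s - 1)) :
    ∃ L, ∀ τ, T ≤ τ → |f τ - L| ≤ C / s * τ ^ (-s) := by
  have hC : 0 ≤ C := by
    have h := (abs_nonneg _).trans (hb T le_rfl)
    exact nonneg_of_mul_nonneg_left h (Real.rpow_pos_of_pos hT _)
  have hr : ∀ τ, T ≤ τ → HasDerivAt (fun τ => C / s * τ ^ (-s)) (-(C * τ ^ (-s - 1))) τ := by
    intro τ hτ
    have h := (Real.hasDerivAt_rpow_const (x := τ) (p := -s)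
      (Or.inl (hT.trans_le hτ).ne')).const_mul (C / s)
    have e : C / s * (-s * τ ^ (-s - 1)) = -(C * τ ^ (-s - 1)) := by
      field_simp
    rwa [e] at h
  have hA : MonotoneOn (fun τ => f τ - C / s * τ ^ (-s)) (Ici T) := by
    have hd : ∀ τ, T ≤ τ → HasDerivAt (fun τ => f τ - C / s * τ ^ (-s))
        (f' τ - -(C * τ ^ (-s - 1))) τ := fun τ hτ => (hf τ hτ).fun_sub (hr τ hτ)
    refine monotoneOn_of_deriv_nonneg (convex_Ici T)
      (fun τ hτ => (hd τ hτ).continuousAt.continuousWithinAt)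
      (fun τ hτ => (hd τ (interior_subset hτ)).differentiableAt.differentiableWithinAt) ?_
    intro τ hτ
    rw [(hd τ (interior_subset hτ)).deriv]
    linarith [neg_le_of_abs_le (hb τ (interior_subset hτ))]
  have hB : AntitoneOn (fun τ => f τ + C / s * τ ^ (-s)) (Ici T) := by
    have hd : ∀ τ, T ≤ τ → HasDerivAt (fun τ => f τ + C / s * τ ^ (-s))
        (f' τ + -(C * τ ^ (-s - 1))) τ := fun τ hτ => (hf τ hτ).fun_add (hr τ hτ)
    refine antitoneOn_of_deriv_nonpos (convex_Ici T)
      (fun τ hτ => (hd τ hτ).continuousAt.continuousWithinAt)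
      (fun τ hτ => (hd τ (interior_subset hτ)).differentiableAt.differentiableWithinAt) ?_
    intro τ hτ
    rw [(hd τ (interior_subset hτ)).deriv]
    linarith [le_of_abs_le (hb τ (interior_subset hτ))]
  have hpos : ∀ τ, T ≤ τ → 0 ≤ C / s * τ ^ (-s) := fun τ hτ =>
    mul_nonneg (div_nonneg hC hs.le) (Real.rpow_nonneg (hT.le.trans hτ) _)
  have hAB : ∀ x, T ≤ x → ∀ y, T ≤ y →
      f x - C / s * x ^ (-s) ≤ f y + C / s * y ^ (-s) := by
    intro x hx y hy
    have hm : T ≤ max x y := le_max_of_le_left hx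
    have h1 := hA hx hm (le_max_left x y)
    have h2 := hB hy hm (le_max_right x y)
    have h3 := hpos _ hm
    simp only at h1 h2
    linarith
  set S := (fun τ => f τ - C / s * τ ^ (-s)) '' Ici T with hS
  have hne : S.Nonempty := ⟨_, mem_image_of_mem _ (self_mem_Ici (a := T))⟩
  have hle : ∀ y, T ≤ y → sSup S ≤ f y + C / s * y ^ (-s) := by
    intro y hy
    refine csSup_le hne ?_
    rintro _ ⟨x, hx, rfl⟩
    exact hAB x hx y hy
  have hbdd : BddAbove S := by
    refine ⟨f T + C / s * T ^ (-s), ?_⟩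
    rintro _ ⟨x, hx, rfl⟩
    exact hAB x hx T le_rfl
  refine ⟨sSup S, fun τ hτ => abs_le.2 ⟨?_, ?_⟩⟩
  · linarith [hle τ hτ]
  · have : f τ - C / s * τ ^ (-s) ≤ sSup S := le_csSup hbdd ⟨τ, hτ, rfl⟩
    linarith

/-! ### Asymptotics for perturbed Euler equations -/

/-- One factor of the Euler operator `τ²∂² + 2τ∂ + r r'`, where `r + r' = 1`: it is
`(τ∂ + r)(τ∂ + r')`, and `τ ^ r` is an integrating factor for `τ∂ + r`. -/
theorem exists_euler_mode {u u₁ u₂ : ℝ → ℝ} {r r' β C T : ℝ} (hr : r + r' = 1) (hβ : r < β)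
    (hT : 0 < T) (hu : ∀ τ, T ≤ τ → HasDerivAt u (u₁ τ) τ)
    (hu₁ : ∀ τ, T ≤ τ → HasDerivAt u₁ (u₂ τ) τ)
    (hg : ∀ τ, T ≤ τ → |τ ^ 2 * u₂ τ + 2 * τ * u₁ τ + r * r' * u τ| ≤ C * τ ^ (-β)) :
    ∃ L, ∀ τ, T ≤ τ → |τ * u₁ τ + r' * u τ - L * τ ^ (-r)| ≤ C / (β - r) * τ ^ (-β) := by
  have hd : ∀ τ, T ≤ τ → HasDerivAt (fun τ => τ ^ r * (τ * u₁ τ + r' * u τ))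
      (τ ^ (r - 1) * (τ ^ 2 * u₂ τ + 2 * τ * u₁ τ + r * r' * u τ)) τ := by
    intro τ hτ
    have hτ0 := hT.trans_le hτ
    have h1 := (Real.hasDerivAt_rpow_const (x := τ) (p := r) (Or.inl hτ0.ne')).fun_mul
      (((hasDerivAt_id' τ).fun_mul (hu₁ τ hτ)).fun_add ((hu τ hτ).const_mul r'))
    have e : τ ^ r = τ ^ (r - 1) * τ := by
      rw [← Real.rpow_add_one hτ0.ne', sub_add_cancel]
    refine h1.congr_deriv ?_
    rw [e]
    linear_combination (τ ^ (r - 1) * τ * u₁ τ) * hr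
  obtain ⟨L, hL⟩ := exists_limit_of_deriv_le (C := C) (s := β - r) (sub_pos.2 hβ) hT hd (by
    intro τ hτ
    have hτ0 := hT.trans_le hτ
    rw [abs_mul, abs_of_pos (Real.rpow_pos_of_pos hτ0 _)]
    calc _ ≤ τ ^ (r - 1) * (C * τ ^ (-β)) :=
          mul_le_mul_of_nonneg_left (hg τ hτ) (Real.rpow_nonneg hτ0.le _)
      _ = C * (τ ^ (r - 1) * τ ^ (-β)) := by ring
      _ = _ := by rw [← Real.rpow_add hτ0]; ring_nf)
  refine ⟨L, fun τ hτ => ?_⟩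
  have hτ0 := hT.trans_le hτ
  have e1 : τ ^ (-r) * τ ^ r = 1 := by rw [← Real.rpow_add hτ0]; simp
  calc |τ * u₁ τ + r' * u τ - L * τ ^ (-r)|
      = |τ ^ (-r) * (τ ^ r * (τ * u₁ τ + r' * u τ) - L)| := by
        congr 1
        linear_combination -(τ * u₁ τ + r' * u τ) * e1
    _ = τ ^ (-r) * |τ ^ r * (τ * u₁ τ + r' * u τ) - L| := by
        rw [abs_mul, abs_of_pos (Real.rpow_pos_of_pos hτ0 _)]
    _ ≤ τ ^ (-r) * (C / (β - r) * τ ^ (-(β - r))) :=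
        mul_le_mul_of_nonneg_left (hL τ hτ) (Real.rpow_nonneg hτ0.le _)
    _ = C / (β - r) * (τ ^ (-r) * τ ^ (-(β - r))) := by ring
    _ = _ := by rw [← Real.rpow_add hτ0]; ring_nf

/-- The asymptotic expansion of a solution of `τ²u'' + 2τu' + μ(1-μ)u = O(τ ^ (-β))`, whose
homogeneous solutions are `τ ^ (-μ)` and `τ ^ (μ-1)`, when `β` exceeds both `μ` and `1 - μ`. -/
theorem exists_euler_expansion {u u₁ u₂ : ℝ → ℝ} {μ β C T : ℝ} (hμ : μ < 1 / 2) (hβ : 1 - μ < β)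
    (hT : 0 < T) (hu : ∀ τ, T ≤ τ → HasDerivAt u (u₁ τ) τ)
    (hu₁ : ∀ τ, T ≤ τ → HasDerivAt u₁ (u₂ τ) τ)
    (hg : ∀ τ, T ≤ τ → |τ ^ 2 * u₂ τ + 2 * τ * u₁ τ + μ * (1 - μ) * u τ| ≤ C * τ ^ (-β)) :
    ∃ a b K, ∀ τ, T ≤ τ → |u τ - a * τ ^ (-μ) - b * τ ^ (μ - 1)| ≤ K * τ ^ (-β) ∧
      |τ * u₁ τ + μ * a * τ ^ (-μ) + (1 - μ) * b * τ ^ (μ - 1)| ≤ K * τ ^ (-β) := by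
  obtain ⟨A, hA⟩ := exists_euler_mode (r := μ) (r' := 1 - μ) (by ring) (by linarith) hT hu hu₁ hg
  obtain ⟨B, hB⟩ := exists_euler_mode (r := 1 - μ) (r' := μ) (by ring) hβ hT hu hu₁
    (fun τ hτ => by rw [mul_comm (1 - μ) μ]; exact hg τ hτ)
  set k := 1 - 2 * μ with hk
  have hk0 : 0 < k := by linarith
  set KA := C / (β - μ)
  set KB := C / (β - (1 - μ))
  refine ⟨A / k, -B / k, ((1 + |μ|) * KA + (1 + |1 - μ|) * KB) / k, fun τ hτ => ?_⟩
  have hτ0 := hT.trans_le hτ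
  have hA := hA τ hτ
  have hB := hB τ hτ
  rw [neg_sub] at hB
  set p := τ * u₁ τ + (1 - μ) * u τ - A * τ ^ (-μ) with hp
  set q := τ * u₁ τ + μ * u τ - B * τ ^ (μ - 1) with hq
  set H := τ ^ (-β)
  have hKA : 0 ≤ KA * H := (abs_nonneg _).trans hA
  have hKB : 0 ≤ KB * H := (abs_nonneg _).trans hB
  constructor
  · have e : u τ - A / k * τ ^ (-μ) - -B / k * τ ^ (μ - 1) = (p - q) / k := by
      rw [hp, hq]; field_simp; ring
    rw [e, abs_div, abs_of_pos hk0, div_mul_eq_mul_div]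
    gcongr
    have h1 : 0 ≤ |μ| * (KA * H) := by positivity
    have h2 : 0 ≤ |1 - μ| * (KB * H) := by positivity
    calc |p - q| ≤ |p| + |q| := abs_sub _ _
      _ ≤ _ := by linarith
  · have e : τ * u₁ τ + μ * (A / k) * τ ^ (-μ) + (1 - μ) * (-B / k) * τ ^ (μ - 1) =
        ((1 - μ) * q - μ * p) / k := by
      rw [hp, hq]; field_simp; ring
    rw [e, abs_div, abs_of_pos hk0, div_mul_eq_mul_div]
    gcongr
    have h1 : |μ| * |p| ≤ |μ| * (KA * H) := by gcongr
    have h2 : |1 - μ| * |q| ≤ |1 - μ| * (KB * H) := by gcongr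
    calc |(1 - μ) * q - μ * p| ≤ |(1 - μ) * q| + |μ * p| := abs_sub _ _
      _ ≤ _ := by rw [abs_mul, abs_mul]; linarith

/-- If moreover the right-hand side is at most quadratic, `O(u² / τ)`, and `u` is bounded, then the
error is `O(τ ^ (-1-2μ))`: a first application with `β = 1` gives `u = O(τ ^ (-μ))`, and a second
one with `β = 1 + 2μ` concludes. -/
theorem exists_euler_expansion_of_quadratic {u u₁ u₂ : ℝ → ℝ} {μ C T : ℝ} (hμ₀ : 0 < μ)
    (hμ : μ < 1 / 2) (hT : 1 ≤ T) (hu : ∀ τ, T ≤ τ → HasDerivAt u (u₁ τ) τ)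
    (hu₁ : ∀ τ, T ≤ τ → HasDerivAt u₁ (u₂ τ) τ) (hC : 0 ≤ C) (hbd : ∀ τ, T ≤ τ → |u τ| ≤ 1)
    (hg : ∀ τ, T ≤ τ → |τ ^ 2 * u₂ τ + 2 * τ * u₁ τ + μ * (1 - μ) * u τ| ≤ C * (u τ ^ 2 / τ)) :
    ∃ a b K, ∀ τ, T ≤ τ → |u τ - a * τ ^ (-μ) - b * τ ^ (μ - 1)| ≤ K * τ ^ (-1 - 2 * μ) ∧
      |τ * u₁ τ + μ * a * τ ^ (-μ) + (1 - μ) * b * τ ^ (μ - 1)| ≤ K * τ ^ (-1 - 2 * μ) ∧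
      |τ ^ 2 * u₂ τ + 2 * τ * u₁ τ + μ * (1 - μ) * u τ| ≤ K * τ ^ (-1 - 2 * μ) := by
  have hT0 : 0 < T := one_pos.trans_le hT
  obtain ⟨M, hM0, hM⟩ : ∃ M, 0 ≤ M ∧ ∀ τ, T ≤ τ → |u τ| ≤ M * τ ^ (-μ) := by
    obtain ⟨a, b, K, h⟩ := exists_euler_expansion (β := 1) (C := C) hμ (by linarith) hT0 hu hu₁ (by
      intro τ hτ
      have hτ0 := hT0.trans_le hτ
      rw [Real.rpow_neg_one, ← one_div]
      refine (hg τ hτ).trans ?_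
      gcongr
      rw [← sq_abs]
      exact pow_le_one₀ (abs_nonneg _) (hbd τ hτ))
    refine ⟨|a| + |b| + |K|, by positivity, fun τ hτ => ?_⟩
    have hτ0 := hT0.trans_le hτ
    have hτ1 := hT.trans hτ
    have h := (h τ hτ).1
    have r1 : τ ^ (μ - 1) ≤ τ ^ (-μ) := Real.rpow_le_rpow_of_exponent_le hτ1 (by linarith)
    have r2 : τ ^ (-1 : ℝ) ≤ τ ^ (-μ) := Real.rpow_le_rpow_of_exponent_le hτ1 (by linarith)
    calc |u τ| = |(u τ - a * τ ^ (-μ) - b * τ ^ (μ - 1)) + a * τ ^ (-μ) + b * τ ^ (μ - 1)| := by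
          congr 1; ring
      _ ≤ |u τ - a * τ ^ (-μ) - b * τ ^ (μ - 1)| + |a * τ ^ (-μ)| + |b * τ ^ (μ - 1)| :=
          abs_add_three _ _ _
      _ ≤ |K| * τ ^ (-1 : ℝ) + |a| * τ ^ (-μ) + |b| * τ ^ (μ - 1) := by
          rw [abs_mul, abs_mul, abs_of_pos (Real.rpow_pos_of_pos hτ0 (-μ)),
            abs_of_pos (Real.rpow_pos_of_pos hτ0 (μ - 1))]
          gcongr
          exact h.trans (mul_le_mul_of_nonneg_right (le_abs_self K)
            (Real.rpow_nonneg hτ0.le _))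
      _ ≤ |K| * τ ^ (-μ) + |a| * τ ^ (-μ) + |b| * τ ^ (-μ) := by gcongr
      _ = _ := by ring
  have hg2 : ∀ τ, T ≤ τ → |τ ^ 2 * u₂ τ + 2 * τ * u₁ τ + μ * (1 - μ) * u τ| ≤
      C * M ^ 2 * τ ^ (-1 - 2 * μ) := by
    intro τ hτ
    have hτ0 := hT0.trans_le hτ
    refine (hg τ hτ).trans ?_
    rw [mul_assoc]
    gcongr
    have e : (M * τ ^ (-μ)) ^ 2 / τ = M ^ 2 * τ ^ (-1 - 2 * μ) := by
      rw [mul_pow, mul_div_assoc, ← Real.rpow_natCast (τ ^ (-μ)), ← Real.rpow_mul hτ0.le,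
        ← Real.rpow_sub_one hτ0.ne']
      congr 2
      push_cast
      ring
    rw [← e, ← sq_abs (u τ)]
    gcongr
    exact hM τ hτ
  obtain ⟨a, b, K, h⟩ := exists_euler_expansion (β := 1 + 2 * μ) (C := C * M ^ 2) hμ
    (by linarith) hT0 hu hu₁ (fun τ hτ => by rw [neg_add']; exact hg2 τ hτ)
  rw [neg_add'] at h
  refine ⟨a, b, max K (C * M ^ 2), fun τ hτ => ?_⟩
  have hr : 0 ≤ τ ^ (-1 - 2 * μ) := Real.rpow_nonneg (hT0.trans_le hτ).le _
  exact ⟨(h τ hτ).1.trans (mul_le_mul_of_nonneg_right (le_max_left _ _) hr),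
    (h τ hτ).2.trans (mul_le_mul_of_nonneg_right (le_max_left _ _) hr),
    (hg2 τ hτ).trans (mul_le_mul_of_nonneg_right (le_max_right _ _) hr)⟩

/-- A positive function that decays no faster than `τ ^ (-1/2)` has a positive coefficient at
`τ ^ (-μ)`, since the other terms of its expansion are `o(τ ^ (-1/2))`. -/
theorem euler_coeff_pos {u u₁ : ℝ → ℝ} {μ a b K T : ℝ} (hμ₀ : 0 < μ) (hμ : μ < 1 / 2) (hT : 0 < T)
    (hu : ∀ τ, T ≤ τ → HasDerivAt u (u₁ τ) τ) (hpos : 0 < u T)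
    (hd : ∀ τ, T ≤ τ → -(u τ / (2 * τ)) ≤ u₁ τ)
    (h : ∀ τ, T ≤ τ → |u τ - a * τ ^ (-μ) - b * τ ^ (μ - 1)| ≤ K * τ ^ (-1 - 2 * μ)) : 0 < a := by
  have hder : ∀ τ, T ≤ τ → HasDerivAt (fun τ => u τ * τ ^ (1 / 2 : ℝ))
      (u₁ τ * τ ^ (1 / 2 : ℝ) + u τ * (1 / 2 * τ ^ (1 / 2 - 1 : ℝ))) τ := fun τ hτ =>
    (hu τ hτ).fun_mul (Real.hasDerivAt_rpow_const (Or.inl (hT.trans_le hτ).ne'))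
  have hmono : MonotoneOn (fun τ => u τ * τ ^ (1 / 2 : ℝ)) (Ici T) := by
    refine monotoneOn_of_deriv_nonneg (convex_Ici T)
      (fun τ hτ => (hder τ hτ).continuousAt.continuousWithinAt)
      (fun τ hτ => (hder τ (interior_subset hτ)).differentiableAt.differentiableWithinAt) ?_
    intro τ hτ
    have hτ := interior_subset hτ
    have hτ0 : 0 < τ := hT.trans_le hτ
    rw [(hder τ hτ).deriv, Real.rpow_sub_one hτ0.ne']
    have e : u₁ τ * τ ^ (1 / 2 : ℝ) + u τ * (1 / 2 * (τ ^ (1 / 2 : ℝ) / τ)) =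
        τ ^ (1 / 2 : ℝ) * (u₁ τ - -(u τ / (2 * τ))) := by field_simp; ring
    rw [e]
    exact mul_nonneg (Real.rpow_nonneg hτ0.le _) (sub_nonneg.2 (hd τ hτ))
  by_contra! ha
  set c₀ := u T * T ^ (1 / 2 : ℝ)
  have hc₀ : 0 < c₀ := mul_pos hpos (Real.rpow_pos_of_pos hT _)
  have hlim : Tendsto (fun τ : ℝ => b * τ ^ (-(1 / 2 - μ)) + K * τ ^ (-(1 / 2 + 2 * μ))) atTop
      (𝓝 (b * 0 + K * 0)) :=
    ((tendsto_rpow_neg_atTop (by linarith)).const_mul b).add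
      ((tendsto_rpow_neg_atTop (by linarith)).const_mul K)
  rw [mul_zero, mul_zero, add_zero] at hlim
  obtain ⟨τ, hτ, hlt⟩ := ((eventually_ge_atTop T).and (hlim.eventually (gt_mem_nhds hc₀))).exists
  have hτ0 : 0 < τ := hT.trans_le hτ
  have h1 : c₀ ≤ u τ * τ ^ (1 / 2 : ℝ) := hmono self_mem_Ici hτ hτ
  have h2 : u τ ≤ b * τ ^ (μ - 1) + K * τ ^ (-1 - 2 * μ) := by
    have := le_of_abs_le (h τ hτ)
    have := mul_nonpos_of_nonpos_of_nonneg ha (Real.rpow_nonneg hτ0.le (-μ))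
    linarith
  have h3 := mul_le_mul_of_nonneg_right h2 (Real.rpow_nonneg hτ0.le (1 / 2 : ℝ))
  have e1 : τ ^ (μ - 1) * τ ^ (1 / 2 : ℝ) = τ ^ (-(1 / 2 - μ)) := by
    rw [← Real.rpow_add hτ0]; congr 1; ring
  have e2 : τ ^ (-1 - 2 * μ) * τ ^ (1 / 2 : ℝ) = τ ^ (-(1 / 2 + 2 * μ)) := by
    rw [← Real.rpow_add hτ0]; congr 1; ring
  rw [add_mul, mul_assoc, mul_assoc, e1, e2] at h3
  linarith

/-- A power bound near infinity extends to `[1, ∞)` by compactness. -/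
theorem exists_rpow_bound {f : ℝ → ℝ} {s K T : ℝ} (hf : ContinuousOn f (Ici 1))
    (hb : ∀ τ, T ≤ τ → |f τ| ≤ K * τ ^ s) : ∃ K', ∀ τ, 1 ≤ τ → |f τ| ≤ K' * τ ^ s := by
  have hc : ContinuousOn (fun τ : ℝ => f τ * τ ^ (-s)) (Icc 1 T) :=
    (hf.mono Icc_subset_Ici_self).mul
      (continuousOn_id.rpow_const fun x hx => Or.inl (one_pos.trans_le hx.1).ne')
  obtain ⟨M, hM⟩ := isCompact_Icc.exists_bound_of_continuousOn hc
  refine ⟨max M K, fun τ hτ => ?_⟩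
  have hτ0 := one_pos.trans_le hτ
  have hr := Real.rpow_pos_of_pos hτ0 s
  rcases le_total τ T with h | h
  · have := hM τ ⟨hτ, h⟩
    rw [Real.norm_eq_abs, abs_mul, abs_of_pos (Real.rpow_pos_of_pos hτ0 _),
      Real.rpow_neg hτ0.le, ← div_eq_mul_inv, div_le_iff₀ hr] at this
    exact this.trans (mul_le_mul_of_nonneg_right (le_max_left _ _) hr.le)
  · exact (hb τ h).trans (mul_le_mul_of_nonneg_right (le_max_right _ _) hr.le)

/-! ### Asymptotics of a leaf profile -/

namespace IsLeafProfile

variable {μ : ℝ} {φ σ : ℝ → ℝ}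

theorem sub_le_one (h : IsLeafProfile φ σ) {τ : ℝ} (hτ : 0 < τ) : σ τ - τ ≤ 1 := by
  have hd : ∀ τ, HasDerivAt (fun τ => σ τ - τ) (deriv σ τ - 1) τ := fun τ =>
    (h.hasDerivAt τ).fun_sub (hasDerivAt_id' τ)
  have hanti : AntitoneOn (fun τ => σ τ - τ) (Ici 0) := by
    refine antitoneOn_of_deriv_nonpos (convex_Ici 0)
      (fun τ _ => (hd τ).continuousAt.continuousWithinAt)
      (fun τ _ => (hd τ).differentiableAt.differentiableWithinAt) ?_
    intro τ hτ
    rw [interior_Ici] at hτ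
    rw [(hd τ).deriv]
    linarith [(h.trapped τ hτ).2.1]
  have := hanti self_mem_Ici hτ.le hτ.le
  simpa [h.zero] using this

theorem sub_id_pos (h : IsLeafProfile φ σ) (τ : ℝ) : 0 < σ τ - τ :=
  sub_pos.2 ((le_abs_self τ).trans_lt (h.gt_abs τ))

/-- The trapping condition `z > 3/2 - w/2`, in terms of `u = σ - τ`: it reads `u' > -u / (2τ)`. -/
theorem neg_le_deriv_sub_one (h : IsLeafProfile φ σ) {τ : ℝ} (hτ : 0 < τ) :
    -((σ τ - τ) / (2 * τ)) ≤ deriv σ τ - 1 := by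
  have h1 := (h.trapped τ hτ).2.2
  have e : (σ τ - τ) / (2 * τ) = σ τ / τ / 2 - 1 / 2 := by field_simp
  rw [e]
  linarith

/-- For `u = σ - τ`, the equation `G(σ) = 0` is a quadratic perturbation of the Euler equation
`τ²u'' + 2τu' + μ(1-μ)u = 0`. -/
theorem exists_euler_le (hφ : IsIntegrandProfile μ φ) (hμ₀ : 0 < μ) (hμ : μ < 1 / 2)
    (h : IsLeafProfile φ σ) : ∃ C T : ℝ, 0 ≤ C ∧ 1 ≤ T ∧ ∀ τ, T ≤ τ →
      |τ ^ 2 * iteratedDeriv 2 σ τ + 2 * τ * (deriv σ τ - 1) + μ * (1 - μ) * (σ τ - τ)| ≤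
        C * ((σ τ - τ) ^ 2 / τ) := by
  have hs := hφ.deriv_two_one_ne_zero hμ₀ hμ
  obtain ⟨K₁, hK₁, hP⟩ := (hφ.analytic.coeffP hs).exists_abs_sub_le_sq
  obtain ⟨K₂, hK₂, hQ⟩ := (hφ.analytic.coeffQ hs).exists_abs_sub_le_sq
  obtain ⟨δ, hδ, hball⟩ := Metric.eventually_nhds_iff.1 (hP.and hQ)
  set m := μ * (1 - μ) with hm
  have hm0 : 0 < m := mul_pos hμ₀ (by linarith)
  set α := deriv (coeffP φ) 1 with hα
  have hα' : deriv (coeffQ φ) 1 = 2 - α := by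
    linarith [hφ.deriv_coeffP_add_deriv_coeffQ hμ₀ hμ]
  -- Beyond `δ⁻¹`, the bound `|u'| ≤ u / (2τ)` and `u ≤ 1` bring `u'` within `δ` of `0`.
  refine ⟨K₁ + K₂ + m + |2 - α|, max 1 δ⁻¹, by positivity, le_max_left _ _, fun τ hτ => ?_⟩
  have hτ0 : 0 < τ := one_pos.trans_le ((le_max_left _ _).trans hτ)
  have hu0 := h.sub_id_pos τ
  have hu1 := h.sub_le_one hτ0
  have hlow := h.neg_le_deriv_sub_one hτ0
  have hup := (h.trapped τ hτ0).2.1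
  have hode := h.ode τ hτ0
  have hσ : τ < σ τ := sub_pos.1 hu0
  have hσ0 : 0 < σ τ := hτ0.trans hσ
  set y := deriv σ τ - 1 with hy
  have hz : deriv σ τ = 1 + y := by rw [hy]; ring
  set u := σ τ - τ with hu
  have hyu : |y| ≤ u / (2 * τ) := abs_le.2 ⟨hlow, (by linarith : y ≤ 0).trans (by positivity)⟩
  have hyu' : |y| ≤ u / τ := hyu.trans (by gcongr; linarith)
  have hδτ : |y| < δ := by
    refine hyu.trans_lt ?_
    have : δ⁻¹ ≤ τ := (le_max_right _ _).trans hτ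
    have h2 : 1 ≤ δ * τ := by
      calc (1 : ℝ) = δ * δ⁻¹ := (mul_inv_cancel₀ hδ.ne').symm
        _ ≤ _ := by gcongr
    rw [div_lt_iff₀ (by positivity)]
    linarith
  obtain ⟨hP, hQ⟩ := hball (y := y) (by rw [Real.dist_eq, sub_zero]; exact hδτ)
  rw [hφ.coeffP_one] at hP
  rw [hφ.coeffQ_one, hα'] at hQ
  rw [opG, hz] at hode
  set e₁ := coeffP φ (1 + y) - m - α * y with he₁
  set e₂ := coeffQ φ (1 + y) - -m - (2 - α) * y with he₂
  have hy2 : y ^ 2 ≤ u ^ 2 / τ ^ 2 := by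
    rw [← sq_abs, ← div_pow]
    gcongr
  have hlin : iteratedDeriv 2 σ τ =
      -(1 / τ * (e₁ + m + α * y)) - 1 / σ τ * (e₂ - m + (2 - α) * y) := by
    rw [he₁, he₂]; linear_combination hode
  have key : τ ^ 2 * iteratedDeriv 2 σ τ + 2 * τ * y + m * u =
      -(τ * e₁) - τ ^ 2 / σ τ * e₂ + m * (u ^ 2 / σ τ) + (2 - α) * (y * (τ * u / σ τ)) := by
    have hστ : σ τ = τ + u := by rw [hu]; ring
    rw [hlin, hστ]
    have : τ + u ≠ 0 := by positivity
    field_simp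
    ring
  have b1 : |τ * e₁| ≤ K₁ * (u ^ 2 / τ) := by
    rw [abs_mul, abs_of_pos hτ0]
    calc τ * |e₁| ≤ τ * (K₁ * (u ^ 2 / τ ^ 2)) := by gcongr; exact hP.trans (by gcongr)
      _ = _ := by field_simp
  have b2 : |τ ^ 2 / σ τ * e₂| ≤ K₂ * (u ^ 2 / τ) := by
    rw [abs_mul, abs_of_pos (by positivity : 0 < τ ^ 2 / σ τ)]
    calc τ ^ 2 / σ τ * |e₂| ≤ τ ^ 2 / τ * (K₂ * (u ^ 2 / τ ^ 2)) := by
          gcongr; exact hQ.trans (by gcongr)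
      _ = _ := by field_simp
  have b3 : |m * (u ^ 2 / σ τ)| ≤ m * (u ^ 2 / τ) := by
    rw [abs_of_pos (by positivity)]
    gcongr
  have b4 : |(2 - α) * (y * (τ * u / σ τ))| ≤ |2 - α| * (u ^ 2 / τ) := by
    rw [abs_mul, abs_mul, abs_of_pos (by positivity : 0 < τ * u / σ τ)]
    gcongr
    calc |y| * (τ * u / σ τ) ≤ u / τ * (τ * u / τ) := by gcongr
      _ = _ := by field_simp
  rw [key]
  calc |-(τ * e₁) - τ ^ 2 / σ τ * e₂ + m * (u ^ 2 / σ τ) + (2 - α) * (y * (τ * u / σ τ))|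
      ≤ |τ * e₁| + |τ ^ 2 / σ τ * e₂| + |m * (u ^ 2 / σ τ)| + |(2 - α) * (y * (τ * u / σ τ))| := by
        refine (abs_add_le _ _).trans (add_le_add_left ((abs_add_le _ _).trans
          (add_le_add_left ((abs_sub _ _).trans ?_) _)) _)
        rw [abs_neg]
    _ ≤ _ := by linarith

/-- The asymptotic expansion of one leaf profile, with a constant that may depend on it. -/
theorem exists_expansion (hφ : IsIntegrandProfile μ φ) (hμ₀ : 0 < μ) (hμ : μ < 1 / 2)
    (h : IsLeafProfile φ σ) : ∃ c > (0 : ℝ), ∃ a > (0 : ℝ), ∃ b : ℝ, ∃ F : ℝ → ℝ,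
      IsControlledBy c (fun τ : ℝ => τ ^ (-1 - 2 * μ)) F ∧
      ∀ τ : ℝ, 0 < τ → σ τ = τ + a * τ ^ (-μ) + b * τ ^ (μ - 1) + F τ := by
  obtain ⟨C, T, hC, hT, hg⟩ := h.exists_euler_le hφ hμ₀ hμ
  have hT0 : 0 < T := one_pos.trans_le hT
  set u : ℝ → ℝ := fun τ => σ τ - τ with hudef
  set u₁ : ℝ → ℝ := fun τ => deriv σ τ - 1 with hu₁def
  set u₂ : ℝ → ℝ := iteratedDeriv 2 σ with hu₂def
  have hu : ∀ τ, HasDerivAt u (u₁ τ) τ := fun τ => (h.hasDerivAt τ).fun_sub (hasDerivAt_id' τ)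
  have hu₁ : ∀ τ, HasDerivAt u₁ (u₂ τ) τ := fun τ => (h.hasDerivAt_deriv τ).sub_const 1
  obtain ⟨a, b, K, hK⟩ := exists_euler_expansion_of_quadratic hμ₀ hμ hT (fun τ _ => hu τ)
    (fun τ _ => hu₁ τ) hC (fun τ hτ => by
      rw [abs_of_pos (h.sub_id_pos τ)]; exact h.sub_le_one (hT0.trans_le hτ)) hg
  have ha : 0 < a := euler_coeff_pos hμ₀ hμ hT0 (fun τ _ => hu τ) (h.sub_id_pos T)
    (fun τ hτ => h.neg_le_deriv_sub_one (hT0.trans_le hτ)) (fun τ hτ => (hK τ hτ).1)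
  set F : ℝ → ℝ := fun τ => u τ - a * τ ^ (-μ) - b * τ ^ (μ - 1) with hF
  set F₁ : ℝ → ℝ := fun τ => u₁ τ - a * (-μ * τ ^ (-μ - 1)) - b * ((μ - 1) * τ ^ (μ - 1 - 1))
    with hF₁
  set F₂ : ℝ → ℝ := fun τ => u₂ τ - a * (-μ * ((-μ - 1) * τ ^ (-μ - 1 - 1))) -
    b * ((μ - 1) * ((μ - 1 - 1) * τ ^ (μ - 1 - 1 - 1))) with hF₂
  have hrp : ∀ (p : ℝ) {τ : ℝ}, 0 < τ → HasDerivAt (fun τ : ℝ => τ ^ p) (p * τ ^ (p - 1)) τ :=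
    fun p τ hτ => Real.hasDerivAt_rpow_const (Or.inl hτ.ne')
  have hFd : ∀ τ, 0 < τ → HasDerivAt F (F₁ τ) τ := fun τ hτ =>
    ((hu τ).fun_sub ((hrp _ hτ).const_mul a)).fun_sub ((hrp _ hτ).const_mul b)
  have hF₁d : ∀ τ, 0 < τ → HasDerivAt F₁ (F₂ τ) τ := fun τ hτ =>
    ((hu₁ τ).fun_sub (((hrp _ hτ).const_mul (-μ)).const_mul a)).fun_sub
      (((hrp _ hτ).const_mul (μ - 1)).const_mul b)
  have hF1 : ∀ τ, 0 < τ → deriv F τ = F₁ τ := fun τ hτ => (hFd τ hτ).deriv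
  have hF2 : ∀ τ, 0 < τ → iteratedDeriv 2 F τ = F₂ τ := by
    intro τ hτ
    have hev : deriv F =ᶠ[𝓝 τ] F₁ := by
      filter_upwards [lt_mem_nhds hτ] with x hx using hF1 x hx
    rw [iteratedDeriv_two_eq, hev.deriv_eq, (hF₁d τ hτ).deriv]
  have hmem : ∀ {τ : ℝ}, τ ∈ Ici (1 : ℝ) → 0 < τ := fun hτ => one_pos.trans_le hτ
  have hrc : ∀ p : ℝ, ContinuousOn (fun τ : ℝ => τ ^ p) (Ici 1) := fun p =>
    continuousOn_id.rpow_const fun x hx => Or.inl (hmem hx).ne'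
  have hsmooth : ContDiffOn ℝ ∞ F (Ioi 0) := by
    have hr : ∀ p : ℝ, ContDiffOn ℝ ∞ (fun τ : ℝ => τ ^ p) (Ioi 0) := fun p =>
      contDiffOn_id.rpow_const_of_ne fun x hx => (ne_of_gt hx : x ≠ 0)
    have hσ : ContDiff ℝ ∞ σ := h.analytic.contDiff
    exact ((hσ.contDiffOn.sub contDiffOn_id).sub (contDiffOn_const.mul (hr _))).sub
      (contDiffOn_const.mul (hr _))
  obtain ⟨K₀, hK₀⟩ := exists_rpow_bound (f := F) (s := -1 - 2 * μ) (K := K) (T := T)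
    (fun τ hτ => (hFd τ (hmem hτ)).continuousAt.continuousWithinAt) (fun τ hτ => (hK τ hτ).1)
  -- `τ F'` is the remainder of `τ u'`.
  have hτF₁ : ∀ τ, 0 < τ →
      τ * F₁ τ = τ * u₁ τ + μ * a * τ ^ (-μ) + (1 - μ) * b * τ ^ (μ - 1) := by
    intro τ hτ
    simp only [hF₁]
    rw [Real.rpow_sub_one hτ.ne' (-μ), Real.rpow_sub_one hτ.ne' (μ - 1)]
    field_simp
    ring
  -- The two leading terms solve the homogeneous Euler equation.
  have hτF₂ : ∀ τ, 0 < τ → τ ^ 2 * F₂ τ = (τ ^ 2 * u₂ τ + 2 * τ * u₁ τ + μ * (1 - μ) * u τ) -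
      2 * (τ * F₁ τ) - μ * (1 - μ) * F τ := by
    intro τ hτ
    rw [hτF₁ τ hτ]
    simp only [hF₂, hF]
    rw [Real.rpow_sub_one hτ.ne' (-μ - 1), Real.rpow_sub_one hτ.ne' (μ - 1 - 1),
      Real.rpow_sub_one hτ.ne' (-μ), Real.rpow_sub_one hτ.ne' (μ - 1)]
    field_simp
    ring
  obtain ⟨K₁, hK₁⟩ := exists_rpow_bound (f := F₁) (s := -1 - 2 * μ - 1) (K := K) (T := T)
    (fun τ hτ => (hF₁d τ (hmem hτ)).continuousAt.continuousWithinAt) (by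
      intro τ hτ
      have hτ0 := hT0.trans_le hτ
      have := (hK τ hτ).2.1
      rw [← hτF₁ τ hτ0, abs_mul, abs_of_pos hτ0, mul_comm] at this
      rw [Real.rpow_sub_one hτ0.ne', ← mul_div_assoc, le_div_iff₀ hτ0]
      exact this)
  have hu₂c : Continuous u₂ := h.analytic.deriv_two.continuous
  obtain ⟨K₂, hK₂⟩ := exists_rpow_bound (f := F₂) (s := -1 - 2 * μ - 1 - 1)
    (K := K + 2 * K + |μ * (1 - μ)| * K) (T := T)
    ((hu₂c.continuousOn.sub (continuousOn_const.mul (continuousOn_const.mul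
      (continuousOn_const.mul (hrc _))))).sub (continuousOn_const.mul (continuousOn_const.mul
      (continuousOn_const.mul (hrc _))))) (by
      intro τ hτ
      have hτ0 := hT0.trans_le hτ
      obtain ⟨h0, h1, h2⟩ := hK τ hτ
      rw [← hτF₁ τ hτ0] at h1
      have h3 : |τ ^ 2 * F₂ τ| ≤ (K + 2 * K + |μ * (1 - μ)| * K) * τ ^ (-1 - 2 * μ) := by
        rw [hτF₂ τ hτ0]
        refine (abs_sub _ _).trans ?_
        rw [abs_mul (μ * (1 - μ))]
        have h4 := mul_le_mul_of_nonneg_left h0 (abs_nonneg (μ * (1 - μ)))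
        have h5 := abs_sub (τ ^ 2 * u₂ τ + 2 * τ * u₁ τ + μ * (1 - μ) * u τ) (2 * (τ * F₁ τ))
        rw [abs_mul 2, abs_two] at h5
        linarith
      rw [abs_mul, abs_of_pos (pow_pos hτ0 2), mul_comm] at h3
      rw [Real.rpow_sub_one hτ0.ne', Real.rpow_sub_one hτ0.ne', div_div, ← sq, ← mul_div_assoc,
        le_div_iff₀ (pow_pos hτ0 2)]
      exact h3)
  have hh1 : ∀ τ : ℝ, 0 < τ → deriv (fun τ : ℝ => τ ^ (-1 - 2 * μ)) τ =
      (-1 - 2 * μ) * τ ^ (-1 - 2 * μ - 1) := fun τ hτ => (hrp _ hτ).deriv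
  have hh2 : ∀ τ : ℝ, 0 < τ → iteratedDeriv 2 (fun τ : ℝ => τ ^ (-1 - 2 * μ)) τ =
      (-1 - 2 * μ) * ((-1 - 2 * μ - 1) * τ ^ (-1 - 2 * μ - 1 - 1)) := by
    intro τ hτ
    have hev : deriv (fun τ : ℝ => τ ^ (-1 - 2 * μ)) =ᶠ[𝓝 τ]
        fun τ => (-1 - 2 * μ) * τ ^ (-1 - 2 * μ - 1) := by
      filter_upwards [lt_mem_nhds hτ] with x hx using hh1 x hx
    rw [iteratedDeriv_two_eq, hev.deriv_eq, ((hrp _ hτ).const_mul _).deriv]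
  set N := max 1 (max K₀ (max K₁ K₂)) with hN
  have hN0 : 0 < N := one_pos.trans_le (le_max_left _ _)
  have hN₀ : K₀ ≤ N := (le_max_left _ _).trans (le_max_right _ _)
  have hN₁ : K₁ ≤ N := (le_max_left _ _).trans ((le_max_right _ _).trans (le_max_right _ _))
  have hN₂ : K₂ ≤ N := (le_max_right _ _).trans ((le_max_right _ _).trans (le_max_right _ _))
  refine ⟨N⁻¹, inv_pos.2 hN0, a, ha, b, F, ⟨hsmooth, fun τ hτ => ?_, fun τ hτ => ?_,
    fun τ hτ => ?_⟩, fun τ _ => by simp only [hF, hudef]; ring⟩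
  · have hr := Real.rpow_pos_of_pos (hmem hτ) (-1 - 2 * μ)
    rw [inv_inv, abs_of_pos hr]
    exact (hK₀ τ hτ).trans (by gcongr)
  · have hr := Real.rpow_pos_of_pos (hmem hτ) (-1 - 2 * μ - 1)
    rw [inv_inv, hF1 τ (hmem hτ), hh1 τ (hmem hτ), abs_mul, abs_of_pos hr]
    have h1 : 1 ≤ |-1 - 2 * μ| := by rw [abs_of_neg (by linarith)]; linarith
    calc |F₁ τ| ≤ K₁ * τ ^ (-1 - 2 * μ - 1) := hK₁ τ hτ
      _ ≤ N * (1 * τ ^ (-1 - 2 * μ - 1)) := by rw [one_mul]; gcongr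
      _ ≤ _ := by gcongr
  · have hr := Real.rpow_pos_of_pos (hmem hτ) (-1 - 2 * μ - 1 - 1)
    rw [inv_inv, hF2 τ (hmem hτ), hh2 τ (hmem hτ), abs_mul, abs_mul, abs_of_pos hr]
    have h1 : 1 ≤ |-1 - 2 * μ| := by rw [abs_of_neg (by linarith)]; linarith
    have h2 : 1 ≤ |-1 - 2 * μ - 1| := by rw [abs_of_neg (by linarith)]; linarith
    calc |F₂ τ| ≤ K₂ * τ ^ (-1 - 2 * μ - 1 - 1) := hK₂ τ hτ
      _ ≤ N * (1 * (1 * τ ^ (-1 - 2 * μ - 1 - 1))) := by rw [one_mul, one_mul]; gcongr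
      _ ≤ _ := by gcongr

end IsLeafProfile

theorem mainTheorem2 (μ : ℝ) (hμ_pos : 0 < μ) (hμ_lt : μ < 1 / 2)
    (φ : ℝ → ℝ) (hφ : IsIntegrandProfile μ φ) :
    ∃ c > (0 : ℝ), ∀ σ : ℝ → ℝ, IsLeafProfile φ σ →
      ∃ a > (0 : ℝ), ∃ b : ℝ, ∃ F : ℝ → ℝ,
        IsControlledBy c (fun τ : ℝ => τ ^ (-1 - 2 * μ)) F ∧
        ∀ τ : ℝ, 0 < τ → σ τ = τ + a * τ ^ (-μ) + b * τ ^ (μ - 1) + F τ := by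
  -- By uniqueness, the constant of a single leaf profile (if one exists) serves for all of them.
  by_cases h : ∃ σ₀, IsLeafProfile φ σ₀
  · obtain ⟨σ₀, h₀⟩ := h
    obtain ⟨c, hc, hexp⟩ := h₀.exists_expansion hφ hμ_pos hμ_lt
    refine ⟨c, hc, fun σ hσ => ?_⟩
    rw [hσ.unique hφ h₀]
    exact hexp
  · exact ⟨1, one_pos, fun σ hσ => (h ⟨σ, hσ⟩).elim⟩
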